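/- **Model.** Let $m\ge 1$, $n, C\ge 0$ be integers and $q=\max\{m,n\}$. The deterministic $2$-user Z-interference channel with parameters $(m,n)$ is, per channel use, $$\mathbf y_1=\mathbf D^{q-m}\mathbf x_1\oplus\mathbf D^{q-n}\mathbf x_2,\qquad \mathbf y_2=\mathbf D^{q-m}\mathbf x_2,$$ where $\mathbf x_1\in\mathbb F_2^{m}$ (filled up with zeros at the bottom to length $q$) and $\mathbf x_2\in\mathbb F_2^{q}$ are the inputs of transmitters $1$ and $2$, $\mathbf y_1\in\mathbb F_2^{q}$ and $\mathbf y_2\in\mathbb F_2^{m}$ (the $q-m$ zero entries at the top of $\mathbf D^{q-m}\mathbf x_2$ being omitted) are the outputs at receivers $1$ and $2$, $\mathbf D$ is the $q\times q$ downshift matrix (entries $1$ just below the diagonal and $0$ elsewhere), and $\oplus$ is addition modulo $2$. Transmitter $2$ also sends $C$ bits $\mathbf v_{21}(t)\in\mathbb F_2^{C}$ per channel use to transmitter $1$ over a noiseless and secure link. A code of block length $N$ has independent messages $W_1,W_2$, uniform on sets of sizes $\lceil 2^{NR_1}\rceil$ and $\lceil 2^{NR_2}\rceil$, and independent local randomness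 at each of the two transmitters, independent of the messages, with an arbitrary law on a finite alphabet. The inputs of transmitter $2$ and the link signals are functions of $W_2$ and of the randomness of transmitter $2$; the input of transmitter $1$ at time $t$ is a function of $W_1$, of the randomness of transmitter $1$, and of $\mathbf v_{21}(1),\dots,\mathbf v_{21}(t)$. Receiver $i$ estimates $W_i$ from $\mathbf y_i^N$. A pair $(R_1,R_2)$ with $R_1,R_2\ge0$ is achievable if there is a sequence of such codes, one for each $N$, with perfect secrecy, $I(W_1;\mathbf y_2^N)=I(W_2;\mathbf y_1^N)=0$ for every $N$, and with the probability that some receiver errs tending to $0$ as $N\to\infty$. The secrecy capacity region is the closure of the set of achievable pairs. **Theorem.** If $n/m\ge 2$ (very high interference regime), then for every $C\ge0$ the secrecy capacity region is $$\{(R_1,R_2): 0\le R_1\le m,\ R_2=0\}.$$ In particular, user $2$ can achieve no positive secure rate, whatever the value of $C$. -/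

import Mathlib

open MeasureTheory ProbabilityTheory Filter Topology

namespace ZIC

/-- The `q × q` downshift matrix over the binary field: ones just below the diagonal, zeros
elsewhere. -/
def downshift (q : ℕ) : Matrix (Fin q) (Fin q) (ZMod 2) :=
  fun i j => if (i : ℕ) = j + 1 then 1 else 0

/-- The vector `x` of length `m`, filled up with zeros at the bottom to length `q`. -/
def pad {m : ℕ} (q : ℕ) (x : Fin m → ZMod 2) : Fin q → ZMod 2 :=
  fun i => if h : (i : ℕ) < m then x ⟨i, h⟩ else 0

/-- Output at receiver 1, `y₁ = D^(q-m) x₁ ⊕ D^(q-n) x₂` with `q = max m n`. Index `0` is the top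
entry of a vector. -/
def out₁ (m n : ℕ) (x₁ : Fin m → ZMod 2) (x₂ : Fin (max m n) → ZMod 2) :
    Fin (max m n) → ZMod 2 :=
  (downshift (max m n) ^ (max m n - m)).mulVec (pad (max m n) x₁) +
    (downshift (max m n) ^ (max m n - n)).mulVec x₂

/-- Output at receiver 2, `y₂ = D^(q-m) x₂` with `q = max m n`, as a vector of length `m`: the
`q - m` top entries of `D^(q-m) x₂`, which are always zero, are left out. -/
def out₂ (m n : ℕ) (x₂ : Fin (max m n) → ZMod 2) : Fin m → ZMod 2 :=
  fun i => (downshift (max m n) ^ (max m n - m)).mulVec x₂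
    ⟨max m n - m + i, by have := le_max_left m n; have := i.isLt; omega⟩

/-- A block code of length `N` with `M₁` and `M₂` messages for the deterministic Z-interference
channel with parameters `m`, `n`, whose cooperative link from transmitter 2 to transmitter 1 carries
`C` bits per channel use. Both transmitters may use private (local) randomness. -/
structure Code (m n C N M₁ M₂ : ℕ) where
  /-- size of the alphabet of the local randomness of transmitter 1 -/
  K₁ : ℕ
  /-- size of the alphabet of the local randomness of transmitter 2 -/
  K₂ : ℕ
  /-- law of the local randomness of transmitter 1 -/
  noise₁ : PMF (Fin K₁)
  /-- law of the local randomness of transmitter 2 -/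
  noise₂ : PMF (Fin K₂)
  /-- the channel inputs of transmitter 2, from its own message and randomness -/
  enc₂ : Fin M₂ → Fin K₂ → Fin N → (Fin (max m n) → ZMod 2)
  /-- the signal on the cooperative link, from the message and randomness of transmitter 2 -/
  link : Fin M₂ → Fin K₂ → Fin N → (Fin C → ZMod 2)
  /-- the channel input of transmitter 1 at time `t`, from its own message and randomness and the
  signals received over the cooperative link up to time `t` (causality) -/
  enc₁ : Fin M₁ → Fin K₁ → (t : Fin N) → ({s : Fin N // s ≤ t} → (Fin C → ZMod 2)) →
    (Fin m → ZMod 2)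
  /-- the decoder of receiver 1 -/
  dec₁ : (Fin N → Fin (max m n) → ZMod 2) → Fin M₁
  /-- the decoder of receiver 2 -/
  dec₂ : (Fin N → Fin m → ZMod 2) → Fin M₂

/-- Mutual information `I(X; Y)` under `μ`: the Kullback–Leibler divergence of the joint law from
the product of the marginal laws (in nats). -/
noncomputable def mutualInfo {Ω A B : Type} [MeasurableSpace Ω] [MeasurableSpace A]
    [MeasurableSpace B] (μ : Measure Ω) (X : Ω → A) (Y : Ω → B) : ENNReal :=
  InformationTheory.klDiv (μ.map (fun ω => (X ω, Y ω))) ((μ.map X).prod (μ.map Y))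

namespace Code

variable {m n C N M₁ M₂ : ℕ} (c : Code m n C N M₁ M₂)

/-- Outcomes: the two messages, then the local randomness of the two transmitters. -/
abbrev Outcome : Type := (Fin M₁ × Fin M₂) × (Fin c.K₁ × Fin c.K₂)

/-- The messages are uniform; messages and local randomness are all independent. -/
noncomputable def law : Measure c.Outcome :=
  ((uniformOn Set.univ : Measure (Fin M₁)).prod (uniformOn Set.univ : Measure (Fin M₂))).prod
    (c.noise₁.toMeasure.prod c.noise₂.toMeasure)

/-- The message of user 1. -/
def W₁ (ω : c.Outcome) : Fin M₁ := ω.1.1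

/-- The message of user 2. -/
def W₂ (ω : c.Outcome) : Fin M₂ := ω.1.2

/-- The block of inputs of transmitter 2. -/
def X₂ (ω : c.Outcome) : Fin N → Fin (max m n) → ZMod 2 := c.enc₂ ω.1.2 ω.2.2

/-- The block of signals on the cooperative link. -/
def V (ω : c.Outcome) : Fin N → Fin C → ZMod 2 := c.link ω.1.2 ω.2.2

/-- The block of inputs of transmitter 1. -/
def X₁ (ω : c.Outcome) : Fin N → Fin m → ZMod 2 :=
  fun t => c.enc₁ ω.1.1 ω.2.1 t (fun s => c.V ω s)

/-- The block of outputs at receiver 1. -/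
def Y₁ (ω : c.Outcome) : Fin N → Fin (max m n) → ZMod 2 :=
  fun t => out₁ m n (c.X₁ ω t) (c.X₂ ω t)

/-- The block of outputs at receiver 2. -/
def Y₂ (ω : c.Outcome) : Fin N → Fin m → ZMod 2 :=
  fun t => out₂ m n (c.X₂ ω t)

/-- The probability that at least one receiver decodes its message wrongly. -/
noncomputable def errorProb : ENNReal :=
  c.law {ω | c.dec₁ (c.Y₁ ω) ≠ c.W₁ ω ∨ c.dec₂ (c.Y₂ ω) ≠ c.W₂ ω}

/-- Perfect secrecy at both unintended receivers, over the whole block. -/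
def PerfectlySecret : Prop :=
  mutualInfo c.law c.W₁ c.Y₂ = 0 ∧ mutualInfo c.law c.W₂ c.Y₁ = 0

end Code

/-- The rate pair `R` (in bits per channel use) is securely achievable: there are perfectly secret
`(⌈2^(N R₁)⌉, ⌈2^(N R₂)⌉, N)` codes, one for each `N`, whose error probability tends to `0`. -/
def Achievable (m n C : ℕ) (R : ℝ × ℝ) : Prop :=
  0 ≤ R.1 ∧ 0 ≤ R.2 ∧
    ∃ c : (N : ℕ) → Code m n C N ⌈(2 : ℝ) ^ ((N : ℝ) * R.1)⌉₊ ⌈(2 : ℝ) ^ ((N : ℝ) * R.2)⌉₊,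
      (∀ N, (c N).PerfectlySecret) ∧ Tendsto (fun N => (c N).errorProb) atTop (𝓝 0)

/-- The secrecy capacity region: the closure of the set of securely achievable rate pairs. -/
def secrecyCapacityRegion (m n C : ℕ) : Set (ℝ × ℝ) :=
  closure {R | Achievable m n C R}

end ZIC

namespace ZIC

/-! For `2 * m ≤ n` the signal of transmitter 1 reaches only the lowest `m` of the `n` levels at
receiver 1, while the top `m` levels show all that receiver 2 gets (`out₂_eq_out₁`). So `Y₂` is a
function of `Y₁`, and no use of the link can change this: perfect secrecy of `W₂` against receiver 1
leaves receiver 2 to guess, with success probability `1 / M₂` (`law_correct₂`). A positive `R.2`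
would make this at most `1 / 2` for `N ≥ 1`.

The bound `R.1 ≤ m` is a count: for fixed `W₂` and randomness at most `2 ^ (m * N)` messages of user
1 are decoded correctly (`law_correct₁_le`). Conversely, with transmitter 2 silent, uncoded
transmission reaches every rate up to `m` without error or leakage. -/

lemma downshift_mulVec {q : ℕ} (x : Fin q → ZMod 2) (i : Fin q) :
    (downshift q).mulVec x i = if h : 1 ≤ (i : ℕ) then x ⟨i - 1, by omega⟩ else 0 := by
  unfold Matrix.mulVec dotProduct downshift
  split_ifs with h
  · rw [Finset.sum_eq_single (⟨i - 1, by omega⟩ : Fin q)]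
    · have : (i : ℕ) = i - 1 + 1 := by omega
      simp [← this]
    · intro b _ hb
      have : (i : ℕ) ≠ b + 1 := fun h' => hb (Fin.ext (by simp; omega))
      simp [this]
    · simp
  · refine Finset.sum_eq_zero fun b _ => ?_
    have : (i : ℕ) ≠ b + 1 := by omega
    simp [this]

lemma downshift_pow_mulVec {q : ℕ} (k : ℕ) (x : Fin q → ZMod 2) (i : Fin q) :
    (downshift q ^ k).mulVec x i = if h : k ≤ (i : ℕ) then x ⟨i - k, by omega⟩ else 0 := by
  induction k generalizing i with
  | zero => simp
  | succ k ih =>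
    rw [pow_succ', ← Matrix.mulVec_mulVec, downshift_mulVec]
    by_cases h : 1 ≤ (i : ℕ)
    · rw [dif_pos h, ih]
      by_cases h' : k + 1 ≤ (i : ℕ)
      · rw [dif_pos h', dif_pos (by simp; omega)]
        congr 1
        ext
        simp
        omega
      · rw [dif_neg h', dif_neg (by simp; omega)]
    · rw [dif_neg h, dif_neg (by omega)]

/-- In the very high interference regime the `m` top bits at receiver 1 are free of the signal of
transmitter 1 and coincide with the output at receiver 2. -/
lemma out₂_eq_out₁ {m n : ℕ} (h : 2 * m ≤ n) (x₁ : Fin m → ZMod 2)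
    (x₂ : Fin (max m n) → ZMod 2) (i : Fin m) :
    out₂ m n x₂ i = out₁ m n x₁ x₂ ⟨i, i.isLt.trans_le (le_max_left m n)⟩ := by
  have hi := i.isLt
  have hq : max m n = n := max_eq_right (by omega)
  unfold out₂ out₁
  -- The factor 2 enters in the second condition: `x₁` is shifted down by `n - m ≥ m > i` levels, so
  -- it contributes zero here, whereas `x₂` is not shifted at all.
  rw [Pi.add_apply, downshift_pow_mulVec, downshift_pow_mulVec, downshift_pow_mulVec,
    dif_pos (by simp), dif_neg (by simp only; omega), dif_pos (by simp only; omega), zero_add]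
  congr 1
  ext
  simp only
  omega

lemma out₁_zero_apply {m n : ℕ} (x₁ : Fin m → ZMod 2) (i : Fin m) :
    out₁ m n x₁ 0 ⟨max m n - m + i, by have := le_max_left m n; have := i.isLt; omega⟩ = x₁ i := by
  have hi := i.isLt
  unfold out₁
  rw [Matrix.mulVec_zero, add_zero, downshift_pow_mulVec, dif_pos (by simp)]
  simp [pad]

lemma out₂_zero (m n : ℕ) : out₂ m n 0 = 0 := by
  ext i
  simp [out₂]

lemma measure_map_pair_eq_prod_of_mutualInfo_eq_zero {Ω A B : Type} [MeasurableSpace Ω]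
    [MeasurableSpace A] [MeasurableSpace B] {μ : Measure Ω} [IsFiniteMeasure μ] {X : Ω → A}
    {Y : Ω → B} (h : mutualInfo μ X Y = 0) :
    μ.map (fun ω => (X ω, Y ω)) = (μ.map X).prod (μ.map Y) :=
  InformationTheory.klDiv_eq_zero_iff.1 h

lemma mutualInfo_const_right {Ω A B : Type} [MeasurableSpace Ω] [MeasurableSpace A]
    [MeasurableSpace B] (μ : Measure Ω) [IsProbabilityMeasure μ] {X : Ω → A} (hX : Measurable X)
    (b : B) : mutualInfo μ X (fun _ => b) = 0 := by
  have := Measure.isProbabilityMeasure_map (μ := μ) hX.aemeasurable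
  have h : μ.map (fun ω => (X ω, b)) = (μ.map X).prod (μ.map fun _ => b) := by
    rw [Measure.map_const, measure_univ, one_smul, Measure.prod_dirac,
      Measure.map_map (by fun_prop) hX]
    rfl
  rw [mutualInfo, h, InformationTheory.klDiv_self]

lemma mutualInfo_const_left {Ω A B : Type} [MeasurableSpace Ω] [MeasurableSpace A]
    [MeasurableSpace B] (μ : Measure Ω) [IsProbabilityMeasure μ] {Y : Ω → B} (hY : Measurable Y)
    (a : A) : mutualInfo μ (fun _ => a) Y = 0 := by
  have := Measure.isProbabilityMeasure_map (μ := μ) hY.aemeasurable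
  have h : μ.map (fun ω => (a, Y ω)) = (μ.map fun _ => a).prod (μ.map Y) := by
    rw [Measure.map_const, measure_univ, one_smul, Measure.dirac_prod,
      Measure.map_map (by fun_prop) hY]
    rfl
  rw [mutualInfo, h, InformationTheory.klDiv_self]

lemma uniformOn_univ_fin_singleton {M : ℕ} (w : Fin M) :
    (uniformOn Set.univ : Measure (Fin M)) {w} = (M : ENNReal)⁻¹ := by
  simp [uniformOn_univ]

/-! ### Success probabilities of a single code -/

namespace Code

variable {m n C N M₁ M₂ : ℕ} (c : Code m n C N M₁ M₂)

lemma isProbabilityMeasure_law [NeZero M₁] [NeZero M₂] : IsProbabilityMeasure c.law := by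
  have h₁ : IsProbabilityMeasure (uniformOn Set.univ : Measure (Fin M₁)) :=
    isProbabilityMeasure_uniformOn Set.finite_univ Set.univ_nonempty
  have h₂ : IsProbabilityMeasure (uniformOn Set.univ : Measure (Fin M₂)) :=
    isProbabilityMeasure_uniformOn Set.finite_univ Set.univ_nonempty
  unfold law
  infer_instance

lemma map_W₂_law [NeZero M₁] [NeZero M₂] :
    c.law.map c.W₂ = (uniformOn Set.univ : Measure (Fin M₂)) := by
  have h₁ : IsProbabilityMeasure (uniformOn Set.univ : Measure (Fin M₁)) :=
    isProbabilityMeasure_uniformOn Set.finite_univ Set.univ_nonempty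
  have h₂ : IsProbabilityMeasure (uniformOn Set.univ : Measure (Fin M₂)) :=
    isProbabilityMeasure_uniformOn Set.finite_univ Set.univ_nonempty
  have : c.W₂ = Prod.snd ∘ Prod.fst := rfl
  rw [this, ← Measure.map_map measurable_snd measurable_fst, law, Measure.map_fst_prod,
    measure_univ, one_smul, Measure.map_snd_prod, measure_univ, one_smul]

lemma one_le_correct₁_add_errorProb [NeZero M₁] [NeZero M₂] :
    1 ≤ c.law {ω | c.dec₁ (c.Y₁ ω) = c.W₁ ω} + c.errorProb := by
  have := c.isProbabilityMeasure_law
  rw [← measure_univ (μ := c.law)]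
  refine (measure_mono fun ω _ => ?_).trans (measure_union_le _ _)
  by_cases h : c.dec₁ (c.Y₁ ω) = c.W₁ ω
  · exact Or.inl h
  · exact Or.inr (Or.inl h)

lemma one_le_correct₂_add_errorProb [NeZero M₁] [NeZero M₂] :
    1 ≤ c.law {ω | c.dec₂ (c.Y₂ ω) = c.W₂ ω} + c.errorProb := by
  have := c.isProbabilityMeasure_law
  rw [← measure_univ (μ := c.law)]
  refine (measure_mono fun ω _ => ?_).trans (measure_union_le _ _)
  by_cases h : c.dec₂ (c.Y₂ ω) = c.W₂ ω
  · exact Or.inl h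
  · exact Or.inr (Or.inr h)

/-- If `y₁` is independent of the message of user 2, then receiver 2, whose output is a part of
`y₁`, can only guess. -/
lemma law_correct₂ [NeZero M₁] [NeZero M₂] (h : 2 * m ≤ n) (hc : mutualInfo c.law c.W₂ c.Y₁ = 0) :
    c.law {ω | c.dec₂ (c.Y₂ ω) = c.W₂ ω} = (M₂ : ENNReal)⁻¹ := by
  have := c.isProbabilityMeasure_law
  have hY : Measurable c.Y₁ := measurable_of_countable _
  have hW : Measurable c.W₂ := measurable_of_countable _
  have := Measure.isProbabilityMeasure_map (μ := c.law) hY.aemeasurable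
  let top (y : Fin N → Fin (max m n) → ZMod 2) : Fin N → Fin m → ZMod 2 :=
    fun t i => y t ⟨i, i.isLt.trans_le (le_max_left m n)⟩
  have hS : {ω | c.dec₂ (c.Y₂ ω) = c.W₂ ω} =
      (fun ω => (c.W₂ ω, c.Y₁ ω)) ⁻¹' {p | c.dec₂ (top p.2) = p.1} := by
    ext ω
    have : c.Y₂ ω = top (c.Y₁ ω) := by
      ext t i
      exact out₂_eq_out₁ h _ _ _
    simp [this]
  have hm : MeasurableSet {p : Fin M₂ × (Fin N → Fin (max m n) → ZMod 2) |
      c.dec₂ (top p.2) = p.1} := Set.Countable.measurableSet (Set.to_countable _)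
  rw [hS, ← Measure.map_apply (hW.prodMk hY) hm,
    measure_map_pair_eq_prod_of_mutualInfo_eq_zero hc, Measure.prod_apply_symm hm, map_W₂_law]
  -- Given `y`, the decoder names exactly one message, so every fibre has the same mass `1 / M₂` and
  -- the law of `Y₁` does not matter.
  have hfib (y : Fin N → Fin (max m n) → ZMod 2) :
      (fun w : Fin M₂ => (w, y)) ⁻¹' {p | c.dec₂ (top p.2) = p.1} = {c.dec₂ (top y)} := by
    ext w
    simp [eq_comm]
  simp_rw [hfib, uniformOn_univ_fin_singleton]
  simp

lemma Y₁_congr {ω ω' : c.Outcome} (h₁ : c.X₁ ω = c.X₁ ω') (h₂ : c.X₂ ω = c.X₂ ω') :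
    c.Y₁ ω = c.Y₁ ω' := by
  unfold Y₁
  rw [h₁, h₂]

/-- A block of inputs of transmitter 1 distinguishes at most `2 ^ (m N)` messages, whatever
transmitter 2 does. -/
lemma card_correct₁_le [DecidableEq (Fin M₁)] (w₂ : Fin M₂) (k : Fin c.K₁ × Fin c.K₂) :
    (Finset.univ.filter fun w₁ => c.dec₁ (c.Y₁ ((w₁, w₂), k)) = w₁).card ≤ 2 ^ (m * N) := by
  have hinj : Set.InjOn (fun w₁ => c.X₁ ((w₁, w₂), k))
      (Finset.univ.filter fun w₁ => c.dec₁ (c.Y₁ ((w₁, w₂), k)) = w₁ : Finset (Fin M₁)) := by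
    intro a ha b hb hab
    have ha' := (Finset.mem_filter.1 (Finset.mem_coe.1 ha)).2
    have hb' := (Finset.mem_filter.1 (Finset.mem_coe.1 hb)).2
    have hY : c.Y₁ ((a, w₂), k) = c.Y₁ ((b, w₂), k) := c.Y₁_congr hab rfl
    rw [← ha', ← hb', hY]
  have := Finset.card_le_card_of_injOn _ (t := Finset.univ) (fun _ _ => Finset.mem_univ _) hinj
  simpa [← pow_mul] using this

/-- Conditioning on the randomness and on `W₂` leaves `W₁` uniform, so the counting bound of
`card_correct₁_le` holds uniformly and survives averaging. -/
lemma law_correct₁_le [NeZero M₁] [NeZero M₂] :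
    c.law {ω | c.dec₁ (c.Y₁ ω) = c.W₁ ω} ≤ 2 ^ (m * N) * (M₁ : ENNReal)⁻¹ := by
  have h₁ : IsProbabilityMeasure (uniformOn Set.univ : Measure (Fin M₁)) :=
    isProbabilityMeasure_uniformOn Set.finite_univ Set.univ_nonempty
  have h₂ : IsProbabilityMeasure (uniformOn Set.univ : Measure (Fin M₂)) :=
    isProbabilityMeasure_uniformOn Set.finite_univ Set.univ_nonempty
  have hm (S : Set (Fin M₁ × Fin M₂)) : MeasurableSet S :=
    Set.Countable.measurableSet (Set.to_countable _)
  rw [law, Measure.prod_apply_symm (Set.Countable.measurableSet (Set.to_countable _))]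
  refine (lintegral_mono (g := fun _ => 2 ^ (m * N) * (M₁ : ENNReal)⁻¹) fun k => ?_).trans
    (by simp)
  rw [Measure.prod_apply_symm (hm _)]
  refine (lintegral_mono (g := fun _ => 2 ^ (m * N) * (M₁ : ENNReal)⁻¹) fun w₂ => ?_).trans
    (by simp)
  classical
  have hcard := c.card_correct₁_le w₂ k
  set S : Finset (Fin M₁) := Finset.univ.filter fun w₁ => c.dec₁ (c.Y₁ ((w₁, w₂), k)) = w₁
  have hS : (fun w₁ => (w₁, w₂)) ⁻¹' ((fun p => (p, k)) ⁻¹' {ω | c.dec₁ (c.Y₁ ω) = c.W₁ ω}) =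
      (S : Set (Fin M₁)) := by
    ext w
    simp [S, W₁]
  simp only [hS]
  rw [← sum_measure_singleton]
  simp_rw [uniformOn_univ_fin_singleton]
  rw [Finset.sum_const, nsmul_eq_mul]
  gcongr
  exact_mod_cast hcard

end Code

/-! ### Achievability -/

/-- Sending nothing from transmitter 2 and uncoded messages from transmitter 1. -/
lemma exists_code_errorProb_eq_zero (m n C N : ℕ) {M₁ M₂ : ℕ} (h₀ : 0 < M₁)
    (h₁ : M₁ ≤ 2 ^ (m * N)) (h₂ : M₂ = 1) :
    ∃ c : Code m n C N M₁ M₂, c.PerfectlySecret ∧ c.errorProb = 0 := by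
  subst h₂
  have : NeZero M₁ := ⟨h₀.ne'⟩
  obtain ⟨e⟩ : Nonempty (Fin M₁ ↪ (Fin N → Fin m → ZMod 2)) :=
    Function.Embedding.nonempty_of_card_le (by simpa [← pow_mul] using h₁)
  let c : Code m n C N M₁ 1 :=
    { K₁ := 1
      K₂ := 1
      noise₁ := PMF.pure 0
      noise₂ := PMF.pure 0
      enc₂ := fun _ _ _ => 0
      link := fun _ _ _ => 0
      enc₁ := fun w _ t _ => e w t
      -- The lowest `m` levels at receiver 1 carry `x₁` unchanged, since transmitter 2 is silent.
      dec₁ := fun y => Function.invFun e fun t i =>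
        y t ⟨max m n - m + i, by have := le_max_left m n; have := i.isLt; omega⟩
      dec₂ := fun _ => 0 }
  have := c.isProbabilityMeasure_law
  refine ⟨c, ⟨?_, ?_⟩, ?_⟩
  · have : c.Y₂ = fun _ => 0 := by
      ext ω t : 2
      exact out₂_zero m n
    rw [this]
    exact mutualInfo_const_right _ (measurable_of_countable _) _
  · have : c.W₂ = fun _ => 0 := by
      ext ω : 1
      exact Subsingleton.elim _ _
    rw [this]
    exact mutualInfo_const_left _ (measurable_of_countable _) _
  · have : {ω | c.dec₁ (c.Y₁ ω) ≠ c.W₁ ω ∨ c.dec₂ (c.Y₂ ω) ≠ c.W₂ ω} = ∅ := by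
      rw [Set.eq_empty_iff_forall_notMem]
      rintro ω (h | h)
      · refine h ?_
        have : (fun (t : Fin N) (i : Fin m) => c.Y₁ ω t ⟨max m n - m + i, by
            have := le_max_left m n; have := i.isLt; omega⟩) = e (c.W₁ ω) := by
          ext t i : 2
          exact out₁_zero_apply _ i
        change Function.invFun e _ = _
        rw [this, Function.leftInverse_invFun e.injective]
      · exact h (Subsingleton.elim _ _)
    rw [Code.errorProb, this, measure_empty]

lemma achievable_of_le {m n C : ℕ} {R : ℝ} (h₀ : 0 ≤ R) (h : R ≤ m) : Achievable m n C (R, 0) := by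
  have hcode (N : ℕ) := exists_code_errorProb_eq_zero m n C N
    (M₁ := ⌈(2 : ℝ) ^ ((N : ℝ) * R)⌉₊) (M₂ := ⌈(2 : ℝ) ^ ((N : ℝ) * 0)⌉₊)
    (Nat.ceil_pos.2 (by positivity))
    (by
      rw [Nat.ceil_le]
      push_cast
      rw [← Real.rpow_natCast]
      refine Real.rpow_le_rpow_of_exponent_le one_le_two ?_
      push_cast
      rw [mul_comm]
      gcongr)
    (by simp)
  choose c hs he using hcode
  exact ⟨h₀, le_rfl, c, hs, by simp [he]⟩

/-! ### Converse -/

lemma Achievable.fst_le {m n C : ℕ} {R : ℝ × ℝ} (h : Achievable m n C R) : R.1 ≤ m := by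
  obtain ⟨-, -, c, -, he⟩ := h
  by_contra! hR
  -- The success probability is at most `2 ^ (m * N) / M₁ ≤ (2 ^ (m - R.1)) ^ N`, which decays
  -- geometrically when `R.1 > m`.
  have hbound (N : ℕ) : 1 ≤ ENNReal.ofReal ((2 : ℝ) ^ ((m : ℝ) - R.1)) ^ N + (c N).errorProb := by
    have : NeZero ⌈(2 : ℝ) ^ ((N : ℝ) * R.1)⌉₊ := ⟨(Nat.ceil_pos.2 (by positivity)).ne'⟩
    have : NeZero ⌈(2 : ℝ) ^ ((N : ℝ) * R.2)⌉₊ := ⟨(Nat.ceil_pos.2 (by positivity)).ne'⟩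
    refine (c N).one_le_correct₁_add_errorProb.trans ?_
    gcongr
    refine (c N).law_correct₁_le.trans ?_
    have hM : ENNReal.ofReal ((2 : ℝ) ^ ((N : ℝ) * R.1)) ≤
        (⌈(2 : ℝ) ^ ((N : ℝ) * R.1)⌉₊ : ENNReal) := by
      rw [← ENNReal.ofReal_natCast]
      exact ENNReal.ofReal_le_ofReal (Nat.le_ceil _)
    calc _ ≤ 2 ^ (m * N) * (ENNReal.ofReal ((2 : ℝ) ^ ((N : ℝ) * R.1)))⁻¹ := by gcongr
      _ = _ := by
        have h2 : (2 : ENNReal) ^ (m * N) = ENNReal.ofReal ((2 : ℝ) ^ ((m : ℝ) * N)) := by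
          rw [← Nat.cast_mul, Real.rpow_natCast, ENNReal.ofReal_pow zero_le_two]
          simp
        rw [h2, ← ENNReal.ofReal_inv_of_pos (by positivity), ← ENNReal.ofReal_mul (by positivity),
          ← ENNReal.ofReal_pow (by positivity), ← Real.rpow_neg zero_le_two,
          ← Real.rpow_add two_pos, ← Real.rpow_mul_natCast zero_le_two]
        congr 2
        ring
  have hlim : Tendsto (fun N => ENNReal.ofReal ((2 : ℝ) ^ ((m : ℝ) - R.1)) ^ N +
      (c N).errorProb) atTop (𝓝 (0 + 0)) := by
    refine (ENNReal.tendsto_pow_atTop_nhds_zero_of_lt_one ?_).add he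
    rw [ENNReal.ofReal_lt_one]
    exact Real.rpow_lt_one_of_one_lt_of_neg one_lt_two (by linarith)
  simpa using ge_of_tendsto' hlim hbound

lemma Achievable.snd_eq_zero {m n C : ℕ} (hmn : 2 * m ≤ n) {R : ℝ × ℝ}
    (h : Achievable m n C R) : R.2 = 0 := by
  obtain ⟨-, h₂, c, hs, he⟩ := h
  by_contra hne
  have hpos : 0 < R.2 := lt_of_le_of_ne h₂ (Ne.symm hne)
  have hbound : ∀ᶠ N in atTop, (1 : ENNReal) ≤ 2⁻¹ + (c N).errorProb := by
    -- At `N = 0` there is a single message. For `N ≥ 1` already `2 ^ (N * R.2) > 1`, so the ceiling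
    -- is at least 2; no growth of `M₂` is needed.
    filter_upwards [eventually_ge_atTop 1] with N hN
    have : NeZero ⌈(2 : ℝ) ^ ((N : ℝ) * R.1)⌉₊ := ⟨(Nat.ceil_pos.2 (by positivity)).ne'⟩
    have : NeZero ⌈(2 : ℝ) ^ ((N : ℝ) * R.2)⌉₊ := ⟨(Nat.ceil_pos.2 (by positivity)).ne'⟩
    refine (c N).one_le_correct₂_add_errorProb.trans ?_
    rw [(c N).law_correct₂ hmn (hs N).2]
    have hM : 2 ≤ ⌈(2 : ℝ) ^ ((N : ℝ) * R.2)⌉₊ := by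
      refine Nat.lt_ceil.2 ?_
      push_cast
      exact Real.one_lt_rpow one_lt_two (by positivity)
    gcongr
    exact_mod_cast hM
  have := ge_of_tendsto (he.const_add 2⁻¹) hbound
  norm_num at this

end ZIC

theorem theorem3 (m n C : ℕ) (hm : 0 < m) (hα : 2 ≤ (n : ℝ) / (m : ℝ)) :
    ZIC.secrecyCapacityRegion m n C = {R : ℝ × ℝ | 0 ≤ R.1 ∧ R.1 ≤ (m : ℝ) ∧ R.2 = 0} := by
  have hmn : 2 * m ≤ n := by
    rw [le_div_iff₀ (by exact_mod_cast hm)] at hα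
    exact_mod_cast hα
  -- The achievable pairs already form a closed set, so taking the closure adds nothing.
  have hset : {R | ZIC.Achievable m n C R} =
      {R : ℝ × ℝ | 0 ≤ R.1 ∧ R.1 ≤ (m : ℝ) ∧ R.2 = 0} := by
    ext ⟨r, s⟩
    constructor
    · intro h
      exact ⟨h.1, h.fst_le, h.snd_eq_zero hmn⟩
    · rintro ⟨h₀, h₁, h₂⟩
      obtain rfl : s = 0 := h₂
      exact ZIC.achievable_of_le h₀ h₁
  rw [ZIC.secrecyCapacityRegion, hset]
  refine IsClosed.closure_eq ?_
  exact (isClosed_le continuous_const continuous_fst).inter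
    ((isClosed_le continuous_fst continuous_const).inter
      (isClosed_eq continuous_snd continuous_const))
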